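/- Let $A$ and $B$ be finite sets, let $\Delta \ge 0$ be an integer, and let $M \in \{0,1,\dots,\Delta\}^{A\times B}$ be a matrix whose rank over $\mathbb{R}$ is $r$. A rectangle $R$ of $M$ is a submatrix $M[A',B']$ given by subsets $A' \subseteq A$ and $B' \subseteq B$ (possibly empty); we write $(a,b) \in R$ if $a \in A'$ and $b \in B'$. For $\alpha \in [-1,1]$ put \[ h(\alpha) = \frac12\left(1 - \frac{\arccos(\alpha)}{\pi}\right). \] Then for every integer $k \ge 0$ there is a probability distribution $\mathcal{D}_k$ on the rectangles of $M$ such that for all $a \in A$ and $b \in B$, \[ \Pr_{R \sim \mathcal{D}_k}\bigl[(a,b) \in R\bigr] = \left( h\left( \frac{M_{a,b}}{\Delta\sqrt{r}} \right) \right)^{k}. \] If $M = 0$ (the only case in which the denominator $\Delta\sqrt{r}$ can vanish), the quotient $M_{a,b}/(\Delta\sqrt{r})$ is read as $0$. -/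

import Mathlib

/-- A rectangle of a matrix with rows indexed by `A` and columns indexed by `B`: the
(non-contiguous) submatrix given by a set of rows and a set of columns. -/
@[ext]
structure Rectangle (A B : Type*) where
  /-- the set of selected rows -/
  rows : Set A
  /-- the set of selected columns -/
  cols : Set B

/-- The entry `(a, b)` lies in the rectangle when row `a` and column `b` are selected. -/
instance Rectangle.instMembership (A B : Type*) : Membership (A × B) (Rectangle A B) where
  mem R p := p.1 ∈ R.rows ∧ p.2 ∈ R.cols

/-- The function `h(α) = (1 - arccos(α) / π) / 2`. -/
noncomputable def sheppardH (α : ℝ) : ℝ :=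
  (1 / 2) * (1 - Real.arccos α / Real.pi)

/-!
Rescaling reduces the theorem to writing `M a b = ⟪u a, v b⟫` with `‖u a‖ ≤ √r` and `‖v b‖ ≤ Δ`.
Factor `M = X Y` with `X` of full column rank `r` and let `p` be a probability weight on the rows of
`X` maximising `det G`, where `G = ∑ a, p a • x_a x_aᵀ`. Moving weight towards a row `a` does not
increase the determinant to first order, which says `x_aᵀ G⁻¹ x_a ≤ r` (Kiefer–Wolfowitz). The
matrix `H = X G⁻¹ Xᵀ` satisfies `H diag(p) M = M` and `H diag(p) Hᵀ = H`. So the rows of `H` and the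
columns of `M` are the required vectors for the `p`-weighted inner product: the squared norms of the
former are the `H a a ≤ r`, those of the latter are `p`-averages of squares of entries of `M`.

Vectors of norm at most `1` become unit vectors, with `⟪u a, v b⟫` unchanged, on adding a component
in an extra plane `ℂ`: a real one to each `u a`, an imaginary one to each `v b`. For a standard
Gaussian `x`, the set of `(a, b)` with `0 < ⟪u a, x⟫` and `0 < ⟪v b, x⟫` is a rectangle, and by
Sheppard's formula it contains `(a, b)` with probability `h(⟪u a, v b⟫)`. That formula holds since
the law of `x` on the plane of `u a` and `v b` is rotation invariant and hence has a uniform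
argument. Intersecting `k` independent such rectangles raises the probability to the power `k`.
-/

open Matrix MeasureTheory ProbabilityTheory Set
open scoped RealInnerProductSpace Real

section OptimalDesign

lemma le_natCast_of_one_add_mul_le_one_add_pow {q : ℝ} {d : ℕ}
    (h : ∀ s : ℝ, 0 < s → 1 + s * q ≤ (1 + s) ^ d) : q ≤ d := by
  have hderiv : HasDerivAt (fun s : ℝ => (1 + s) ^ d) d 0 := by
    simpa using ((hasDerivAt_id (0 : ℝ)).const_add 1).fun_pow d
  refine ge_of_tendsto hderiv.tendsto_slope_zero_right ?_
  filter_upwards [self_mem_nhdsWithin] with s hs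
  rw [smul_eq_mul, zero_add, add_zero, one_pow, le_inv_mul_iff₀ hs]
  linarith [h s hs]

lemma exists_mul_eq_and_injective_mulVec {A B K : Type*} [Fintype B] [Field K] (M : Matrix A B K) :
    ∃ (X : Matrix A (Fin M.rank) K) (Y : Matrix (Fin M.rank) B K),
      X * Y = M ∧ Function.Injective X.mulVec := by
  let b : Module.Basis (Fin M.rank) K (LinearMap.range M.mulVecLin) := Module.finBasis K _
  have hcol (j : B) : M.col j ∈ LinearMap.range M.mulVecLin := by
    classical exact ⟨Pi.single j 1, by simp⟩
  refine ⟨.of fun a i => (b i : A → K) a, .of fun i j => b.repr ⟨M.col j, hcol j⟩ i, ?_, ?_⟩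
  · ext a j
    have hsum := congrFun (congrArg Subtype.val (b.sum_repr ⟨M.col j, hcol j⟩)) a
    simpa only [mul_apply, of_apply, mul_comm, AddSubmonoidClass.coe_finsetSum,
      Submodule.coe_smul, Finset.sum_apply, Pi.smul_apply, smul_eq_mul, col_apply] using hsum
  · rw [mulVec_injective_iff]
    exact b.linearIndependent.map' (Submodule.subtype _) (Submodule.ker_subtype _)

variable {A ι R : Type*} [Fintype A] [DecidableEq A] [CommRing R]

/-- The matrix `∑ a, p a • x_a x_aᵀ`, where `x_a` is row `a` of `X`: the information matrix of the
design `p` in the language of optimal design. -/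
def weightedGram (X : Matrix A ι R) (p : A → R) : Matrix ι ι R :=
  Xᵀ * diagonal p * X

lemma weightedGram_add (X : Matrix A ι R) (p q : A → R) :
    weightedGram X (p + q) = weightedGram X p + weightedGram X q := by
  simp only [weightedGram, ← diagonal_add, Matrix.mul_add, Matrix.add_mul, Pi.add_def]

lemma weightedGram_smul (X : Matrix A ι R) (c : R) (p : A → R) :
    weightedGram X (c • p) = c • weightedGram X p := by
  simp only [weightedGram, diagonal_smul, Matrix.mul_smul, Matrix.smul_mul]

lemma weightedGram_single (X : Matrix A ι R) (a : A) :
    weightedGram X (Pi.single a 1) = vecMulVec (X a) (X a) := by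
  ext i j
  rw [weightedGram, mul_apply]
  simp [mul_diagonal, Pi.single_apply, vecMulVec_apply]

lemma posDef_weightedGram [Fintype ι] {X : Matrix A ι ℝ} (hX : Function.Injective X.mulVec)
    {p : A → ℝ} (hp : ∀ a, 0 < p a) : (weightedGram X p).PosDef :=
  (PosDef.diagonal hp).conjTranspose_mul_mul_same hX

variable [Fintype ι] [DecidableEq ι]

/-- The matrix with entries `x_aᵀ G⁻¹ x_b`, where `x_a` is row `a` of `X` and `G` is
`weightedGram X p`. Its diagonal entries are the leverage scores that the Kiefer–Wolfowitz theorem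
bounds. It is meaningful only for nonsingular `G`, as `G⁻¹` is `0` otherwise. -/
noncomputable def leverageMatrix (X : Matrix A ι R) (p : A → R) : Matrix A A R :=
  X * (weightedGram X p)⁻¹ * Xᵀ

lemma leverageMatrix_mul_diagonal_mul {X : Matrix A ι R} {p : A → R}
    (hp : IsUnit (weightedGram X p).det) :
    leverageMatrix X p * diagonal p * X = X := by
  calc leverageMatrix X p * diagonal p * X
      = X * ((weightedGram X p)⁻¹ * weightedGram X p) := by
        simp only [leverageMatrix, weightedGram, Matrix.mul_assoc]
    _ = X := by rw [nonsing_inv_mul _ hp, Matrix.mul_one]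

lemma leverageMatrix_mul_diagonal_mul_transpose {X : Matrix A ι R} {p : A → R}
    (hp : IsUnit (weightedGram X p).det) :
    leverageMatrix X p * diagonal p * (leverageMatrix X p)ᵀ = leverageMatrix X p := by
  have hsymm : (leverageMatrix X p)ᵀ = leverageMatrix X p := by
    simp only [leverageMatrix, weightedGram, transpose_mul, transpose_nonsing_inv,
      diagonal_transpose, transpose_transpose, Matrix.mul_assoc]
  calc leverageMatrix X p * diagonal p * (leverageMatrix X p)ᵀ
      = leverageMatrix X p * diagonal p * X * (weightedGram X p)⁻¹ * Xᵀ := by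
        rw [hsymm]
        nth_rw 2 [leverageMatrix]
        simp only [Matrix.mul_assoc]
    _ = leverageMatrix X p := by rw [leverageMatrix_mul_diagonal_mul hp, leverageMatrix]

lemma det_weightedGram_add_single {X : Matrix A ι R} {p : A → R}
    (hp : IsUnit (weightedGram X p).det) (s : R) (a : A) :
    (weightedGram X (p + s • Pi.single a 1)).det =
      (weightedGram X p).det * (1 + s * leverageMatrix X p a a) := by
  have hlev : leverageMatrix X p a a =
      (replicateRow Unit (X a) * (weightedGram X p)⁻¹ * replicateCol Unit (X a)) () () := by
    simp [leverageMatrix, mul_apply]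
  rw [weightedGram_add, weightedGram_smul, weightedGram_single, ← smul_vecMulVec,
    vecMulVec_eq Unit, det_add_replicateCol_mul_replicateRow hp, replicateCol_smul,
    Matrix.mul_smul, det_unique (n := Unit), hlev]
  rfl

lemma exists_isMaxOn_det_weightedGram [Nonempty A] {X : Matrix A ι ℝ}
    (hX : Function.Injective X.mulVec) :
    ∃ p ∈ stdSimplex ℝ A, 0 < (weightedGram X p).det ∧
      IsMaxOn (fun q => (weightedGram X q).det) (stdSimplex ℝ A) p := by
  have hcont : Continuous fun p : A → ℝ => (weightedGram X p).det := by
    unfold weightedGram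
    fun_prop
  have hunif : (fun _ : A => (Fintype.card A : ℝ)⁻¹) ∈ stdSimplex ℝ A :=
    ⟨fun _ => by positivity, by simp⟩
  obtain ⟨p, hp, hmax⟩ := (isCompact_stdSimplex ℝ A).exists_isMaxOn ⟨_, hunif⟩ hcont.continuousOn
  exact ⟨p, hp, (posDef_weightedGram hX fun _ => by positivity).det_pos.trans_le (hmax hunif), hmax⟩

lemma det_weightedGram_add_single_le {X : Matrix A ι ℝ} {p : A → ℝ} (hp : p ∈ stdSimplex ℝ A)
    (hmax : IsMaxOn (fun q => (weightedGram X q).det) (stdSimplex ℝ A) p) {s : ℝ} (hs : 0 ≤ s)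
    (a : A) :
    (weightedGram X (p + s • Pi.single a 1)).det ≤
      (1 + s) ^ Fintype.card ι * (weightedGram X p).det := by
  have hpos : 0 < 1 + s := by positivity
  set q := (1 / (1 + s)) • p + (s / (1 + s)) • Pi.single a (1 : ℝ) with hq
  have hmem : q ∈ stdSimplex ℝ A :=
    convex_iff_div.1 (convex_stdSimplex ℝ A) hp (single_mem_stdSimplex ℝ a) zero_le_one hs hpos
  have hscale : p + s • Pi.single a 1 = (1 + s) • q := by
    rw [hq, smul_add, smul_smul, smul_smul, mul_one_div_cancel hpos.ne', one_smul,
      mul_div_cancel₀ _ hpos.ne']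
  rw [hscale, weightedGram_smul, det_smul]
  gcongr
  exact hmax hmem

theorem leverageMatrix_apply_self_le_card {X : Matrix A ι ℝ} {p : A → ℝ} (hp : p ∈ stdSimplex ℝ A)
    (hdet : 0 < (weightedGram X p).det)
    (hmax : IsMaxOn (fun q => (weightedGram X q).det) (stdSimplex ℝ A) p) (a : A) :
    leverageMatrix X p a a ≤ Fintype.card ι := by
  refine le_natCast_of_one_add_mul_le_one_add_pow fun s hs => ?_
  have hle := det_weightedGram_add_single_le hp hmax hs.le a
  rw [det_weightedGram_add_single hdet.ne'.isUnit, mul_comm] at hle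
  exact le_of_mul_le_mul_right hle hdet

end OptimalDesign

lemma inner_toLp_sqrt_mul {A : Type*} [Fintype A] {p : A → ℝ} (hp : ∀ i, 0 ≤ p i) (x y : A → ℝ) :
    ⟪WithLp.toLp 2 fun i => √(p i) * x i, WithLp.toLp 2 fun i => √(p i) * y i⟫ =
      ∑ i, p i * (x i * y i) := by
  rw [EuclideanSpace.inner_toLp_toLp, star_trivial, dotProduct]
  refine Finset.sum_congr rfl fun i _ => ?_
  rw [mul_mul_mul_comm, Real.mul_self_sqrt (hp i), mul_comm (y i)]

theorem exists_inner_eq_of_abs_le {A B : Type*} [Fintype A] [Fintype B] (M : Matrix A B ℝ) {Δ : ℝ}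
    (hM : ∀ a b, |M a b| ≤ Δ) :
    ∃ (u : A → EuclideanSpace ℝ A) (v : B → EuclideanSpace ℝ A),
      (∀ a b, ⟪u a, v b⟫ = M a b) ∧ (∀ a, ‖u a‖ ≤ √M.rank) ∧ ∀ b, ‖v b‖ ≤ |Δ| := by
  classical
  cases isEmpty_or_nonempty A
  · exact ⟨isEmptyElim, 0, isEmptyElim, isEmptyElim, fun b => by simp⟩
  obtain ⟨X, Y, hXY, hX⟩ := exists_mul_eq_and_injective_mulVec M
  obtain ⟨p, hp, hdet, hmax⟩ := exists_isMaxOn_det_weightedGram hX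
  have hunit : IsUnit (weightedGram X p).det := hdet.ne'.isUnit
  set H := leverageMatrix X p
  have hHM : H * diagonal p * M = M := by
    rw [← hXY, ← Matrix.mul_assoc, leverageMatrix_mul_diagonal_mul hunit]
  have hHH : H * diagonal p * Hᵀ = H := leverageMatrix_mul_diagonal_mul_transpose hunit
  refine ⟨fun a => WithLp.toLp 2 fun i => √(p i) * H a i,
    fun b => WithLp.toLp 2 fun i => √(p i) * M i b, fun a b => ?_, fun a => ?_, fun b => ?_⟩
  · rw [inner_toLp_sqrt_mul hp.1, ← congrFun₂ hHM a b, mul_apply]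
    simp only [mul_diagonal]
    exact Finset.sum_congr rfl fun i _ => by ring
  · refine Real.le_sqrt_of_sq_le ?_
    calc _ = H a a := by
          rw [← real_inner_self_eq_norm_sq, inner_toLp_sqrt_mul hp.1, ← congrFun₂ hHH a a,
            mul_apply]
          simp only [mul_diagonal, transpose_apply]
          exact Finset.sum_congr rfl fun i _ => by ring
      _ ≤ M.rank := by
          simpa only [Fintype.card_fin] using leverageMatrix_apply_self_le_card hp hdet hmax a
  · refine le_of_sq_le_sq ?_ (abs_nonneg Δ)
    calc _ = ∑ i, p i * (M i b * M i b) := by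
          rw [← real_inner_self_eq_norm_sq, inner_toLp_sqrt_mul hp.1]
      _ ≤ ∑ i, p i * Δ ^ 2 := by
          gcongr with i
          · exact hp.1 i
          · simpa only [← sq] using sq_le_sq' (abs_le.1 (hM i b)).1 (abs_le.1 (hM i b)).2
      _ = |Δ| ^ 2 := by rw [sq_abs, ← Finset.sum_mul, hp.2, one_mul]

section Angle

local instance : Fact (0 < 2 * π) := ⟨Real.two_pi_pos⟩

lemma isUniform_equivIoc_haarAddCircle (T a : ℝ) [hT : Fact (0 < T)] :
    pdf.IsUniform (fun t : AddCircle T => (AddCircle.equivIoc T a t : ℝ)) (Ioc a (a + T))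
      AddCircle.haarAddCircle := by
  have hvol : (volume : Measure (AddCircle T)).map (fun t => (AddCircle.equivIoc T a t : ℝ)) =
      volume.restrict (Ioc a (a + T)) := by
    have hequiv := AddCircle.measurePreserving_equivIoc T (a := a)
    rw [← Function.comp_def, ← Measure.map_map measurable_subtype_coe hequiv.measurable,
      hequiv.map_eq, map_comap_subtype_coe measurableSet_Ioc]
  have hT' : ENNReal.ofReal T ≠ 0 := by simpa using hT.out
  rw [pdf.IsUniform, ProbabilityTheory.cond, ← hvol, AddCircle.volume_eq_smul_haarAddCircle,
    Measure.map_smul, Real.volume_Ioc, add_sub_cancel_left, smul_smul,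
    ENNReal.inv_mul_cancel hT' ENNReal.ofReal_ne_top, one_smul]

lemma measurable_coe_arg : Measurable fun z => (Complex.arg z : AddCircle (2 * π)) :=
  AddCircle.measurable_mk'.comp Complex.measurable_arg

lemma map_arg_eq_haarAddCircle (μ : Measure ℂ) [IsProbabilityMeasure μ]
    (hrot : ∀ w : Circle, μ.map (rotation w) = μ) (hzero : μ {0} = 0) :
    μ.map (fun z => (Complex.arg z : AddCircle (2 * π))) = AddCircle.haarAddCircle := by
  have := Measure.isProbabilityMeasure_map (μ := μ) measurable_coe_arg.aemeasurable
  set ν := μ.map (fun z => (Complex.arg z : AddCircle (2 * π)))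
  have hinv : ν.IsAddLeftInvariant := by
    refine ⟨fun t => ?_⟩
    obtain ⟨w, hw⟩ : ∃ w : Circle, (Complex.arg w : Real.Angle) = t :=
      ⟨_, Real.Angle.arg_toCircle t⟩
    have hshift : (fun z => t + (Complex.arg z : AddCircle (2 * π))) =ᵐ[μ]
        fun z => (Complex.arg (rotation w z) : AddCircle (2 * π)) := by
      filter_upwards [measure_eq_zero_iff_ae_notMem.1 hzero] with z hz
      rw [rotation_apply, ← hw]
      exact (Complex.arg_mul_coe_angle w.coe_ne_zero hz).symm
    calc ν.map (t + ·) = μ.map fun z => t + (Complex.arg z : AddCircle (2 * π)) :=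
          Measure.map_map (measurable_const_add t) measurable_coe_arg
      _ = (μ.map (rotation w)).map fun z => (Complex.arg z : AddCircle (2 * π)) := by
          rw [Measure.map_congr hshift,
            Measure.map_map measurable_coe_arg (rotation w).continuous.measurable]
          rfl
      _ = ν := by rw [hrot]
  have : ν.IsAddHaarMeasure := Measure.isAddHaarMeasure_of_isCompact_nonempty_interior ν univ
    isCompact_univ (by simp) (by simp) (by simp)
  exact Measure.isAddHaarMeasure_eq_of_isProbabilityMeasure _ _

lemma isUniform_arg (μ : Measure ℂ) [IsProbabilityMeasure μ]
    (hrot : ∀ w : Circle, μ.map (rotation w) = μ) (hzero : μ {0} = 0) :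
    pdf.IsUniform Complex.arg (Ioc (-π) π) μ := by
  have hrepr (z : ℂ) : (AddCircle.equivIoc (2 * π) (-π) (Complex.arg z) : ℝ) = Complex.arg z := by
    refine AddCircle.equivIoc_coe_of_mem ?_
    simpa [two_mul] using z.arg_mem_Ioc
  have hunif := isUniform_equivIoc_haarAddCircle (2 * π) (-π)
  have hequiv : Measurable fun t => (AddCircle.equivIoc (2 * π) (-π) t : ℝ) :=
    measurable_subtype_coe.comp (AddCircle.measurePreserving_equivIoc (2 * π)).measurable
  rw [pdf.IsUniform, ← map_arg_eq_haarAddCircle μ hrot hzero,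
    Measure.map_map hequiv measurable_coe_arg] at hunif
  simpa [Function.comp_def, hrepr, two_mul, pdf.IsUniform] using hunif

end Angle

section Sheppard

lemma cos_pos_and_cos_sub_pos_iff {t θ : ℝ} (hθ : θ ∈ Icc 0 π) (ht : t ∈ Ioc (-π) π) :
    0 < Real.cos t ∧ 0 < Real.cos (t - θ) ↔ t ∈ Ioo (θ - π / 2) (π / 2) := by
  obtain ⟨hθ₀, hθπ⟩ := hθ
  constructor
  · rintro ⟨hcos, hcos_sub⟩
    have hlt : t < π / 2 := by
      by_contra! h
      exact hcos.not_ge (Real.cos_nonpos_of_pi_div_two_le_of_le h (by linarith [ht.2]))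
    have hgt : -(π / 2) < t := by
      by_contra! h
      rw [← Real.cos_neg] at hcos
      exact hcos.not_ge
        (Real.cos_nonpos_of_pi_div_two_le_of_le (by linarith) (by linarith [ht.1]))
    refine ⟨?_, hlt⟩
    by_contra! h
    rw [← Real.cos_neg] at hcos_sub
    exact hcos_sub.not_ge
      (Real.cos_nonpos_of_pi_div_two_le_of_le (by linarith) (by linarith))
  · rintro ⟨hlower, hupper⟩
    exact ⟨Real.cos_pos_of_mem_Ioo ⟨by linarith, hupper⟩,
      Real.cos_pos_of_mem_Ioo ⟨by linarith, by linarith⟩⟩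

lemma inner_ofReal_mul_exp (r θ : ℝ) (z : ℂ) :
    ⟪(r : ℂ) * Complex.exp (θ * Complex.I), z⟫ = r * (‖z‖ * Real.cos (z.arg - θ)) := by
  rw [Real.cos_sub, mul_add, ← mul_assoc, ← mul_assoc, Complex.norm_mul_cos_arg,
    Complex.norm_mul_sin_arg]
  simp only [Complex.inner, map_mul, Complex.conj_ofReal, Complex.mul_re, Complex.ofReal_re,
    Complex.conj_re, Complex.exp_re, Complex.I_re, mul_zero, Complex.ofReal_im, Complex.I_im,
    mul_one, sub_self, Real.exp_zero, Complex.mul_im, add_zero, one_mul, Complex.conj_im,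
    Complex.exp_im, mul_neg, zero_mul, neg_zero, sub_zero, sub_neg_eq_add]
  ring

lemma measureReal_inner_pos_and_inner_pos_of_rotation_invariant (μ : Measure ℂ)
    [IsProbabilityMeasure μ] (hrot : ∀ w : Circle, μ.map (rotation w) = μ) (hzero : μ {0} = 0)
    {r s θ : ℝ} (hr : 0 < r) (hs : 0 < s) (hθ : θ ∈ Icc 0 π) :
    μ.real {z | 0 < ⟪(r : ℂ), z⟫ ∧ 0 < ⟪(s : ℂ) * Complex.exp (θ * Complex.I), z⟫} =
      (π - θ) / (2 * π) := by
  have hae : {z : ℂ | 0 < ⟪(r : ℂ), z⟫ ∧ 0 < ⟪(s : ℂ) * Complex.exp (θ * Complex.I), z⟫} =ᵐ[μ]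
      Complex.arg ⁻¹' Ioo (θ - π / 2) (π / 2) := by
    filter_upwards [measure_eq_zero_iff_ae_notMem.1 hzero] with z hz
    have hz' : 0 < ‖z‖ := norm_pos_iff.2 hz
    have hr' := inner_ofReal_mul_exp r 0 z
    simp only [Complex.ofReal_zero, zero_mul, Complex.exp_zero, mul_one, sub_zero] at hr'
    refine propext (Iff.trans ?_ (cos_pos_and_cos_sub_pos_iff hθ z.arg_mem_Ioc))
    change 0 < ⟪(r : ℂ), z⟫ ∧ 0 < ⟪(s : ℂ) * Complex.exp (θ * Complex.I), z⟫ ↔ _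
    rw [hr', inner_ofReal_mul_exp, mul_pos_iff_of_pos_left hr, mul_pos_iff_of_pos_left hz',
      mul_pos_iff_of_pos_left hs, mul_pos_iff_of_pos_left hz']
  have hsub : Ioo (θ - π / 2) (π / 2) ⊆ Ioc (-π) π :=
    fun t ht => ⟨by linarith [ht.1, hθ.1, Real.pi_pos], by linarith [ht.2, Real.pi_pos]⟩
  rw [measureReal_congr hae, ← map_measureReal_apply Complex.measurable_arg measurableSet_Ioo,
    isUniform_arg μ hrot hzero, measureReal_def, ProbabilityTheory.cond_apply measurableSet_Ioc,
    inter_eq_right.2 hsub, ENNReal.toReal_mul, ENNReal.toReal_inv, ← measureReal_def,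
    ← measureReal_def, Real.volume_real_Ioc_of_le (by linarith [Real.pi_pos]),
    Real.volume_real_Ioo_of_le (by linarith [hθ.2])]
  field_simp
  ring

variable {E F : Type*} [NormedAddCommGroup E] [InnerProductSpace ℝ E] [FiniteDimensional ℝ E]
  [MeasurableSpace E] [BorelSpace E] [NormedAddCommGroup F] [InnerProductSpace ℝ F]
  [FiniteDimensional ℝ F] [MeasurableSpace F] [BorelSpace F]

lemma charFunDual_map_inner_stdGaussian {ι : Type*} [Fintype ι] [DecidableEq ι] (u : ι → E)
    (L : StrongDual ℝ (ι → ℝ)) :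
    charFunDual ((stdGaussian E).map (fun x i => ⟪u i, x⟫)) L =
      Complex.exp (-‖∑ i, L (Pi.single i 1) • u i‖ ^ 2 / 2) := by
  let T : E →L[ℝ] ι → ℝ := ContinuousLinearMap.pi fun i => innerSL ℝ (u i)
  have hcomp : L ∘SL T = innerSL ℝ (∑ i, L (Pi.single i 1) • u i) := by
    ext x
    have hL := congrArg L (pi_eq_sum_univ' (T x))
    simpa [T, sum_inner, real_inner_smul_left, mul_comm, ← Pi.single_apply] using hL
  change charFunDual ((stdGaussian E).map T) L = _
  rw [charFunDual_map, charFunDual_stdGaussian, hcomp, innerSL_apply_norm]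

lemma stdGaussian_map_inner_eq_of_gram_eq {ι : Type*} [Finite ι] {u : ι → E} {v : ι → F}
    (h : ∀ i j, ⟪u i, u j⟫ = ⟪v i, v j⟫) :
    (stdGaussian E).map (fun x i => ⟪u i, x⟫) = (stdGaussian F).map (fun x i => ⟪v i, x⟫) := by
  classical
  cases nonempty_fintype ι
  have hu : Measurable fun (x : E) i => ⟪u i, x⟫ := by fun_prop
  have hv : Measurable fun (x : F) i => ⟪v i, x⟫ := by fun_prop
  have := Measure.isProbabilityMeasure_map (μ := stdGaussian E) hu.aemeasurable
  have := Measure.isProbabilityMeasure_map (μ := stdGaussian F) hv.aemeasurable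
  refine Measure.ext_of_charFunDual (funext fun L => ?_)
  have hnorm : ‖∑ i, L (Pi.single i 1) • u i‖ ^ 2 = ‖∑ i, L (Pi.single i 1) • v i‖ ^ 2 := by
    simp only [← real_inner_self_eq_norm_sq, sum_inner, inner_sum, real_inner_smul_left,
      real_inner_smul_right, h]
  simp only [charFunDual_map_inner_stdGaussian, ← Complex.ofReal_pow, hnorm]

lemma stdGaussian_singleton_zero [Nontrivial E] : stdGaussian E {0} = 0 := by
  obtain ⟨e, he⟩ := exists_ne (0 : E)
  have hnull := nullSingletonClass_gaussianReal (μ := 0) (v := (‖e‖ ^ 2).toNNReal)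
    (by simpa using he)
  have hmap : (stdGaussian E).map (innerSL ℝ e) = gaussianReal 0 (‖e‖ ^ 2).toNNReal := by
    rw [IsGaussian.map_eq_gaussianReal, integral_strongDual_stdGaussian, variance_dual_stdGaussian,
      innerSL_apply_norm]
  refine measure_mono_null (t := innerSL ℝ e ⁻¹' {0}) (by simp) ?_
  rw [← Measure.map_apply (by fun_prop) (measurableSet_singleton _), hmap, measure_singleton]

open InnerProductGeometry in
theorem stdGaussian_real_inner_pos_and_inner_pos {u v : E} (hu : u ≠ 0) (hv : v ≠ 0) :
    (stdGaussian E).real {x | 0 < ⟪u, x⟫ ∧ 0 < ⟪v, x⟫} = (π - angle u v) / (2 * π) := by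
  have hQ : MeasurableSet {y : Fin 2 → ℝ | 0 < y 0 ∧ 0 < y 1} :=
    (measurableSet_lt measurable_const (measurable_pi_apply 0)).inter
      (measurableSet_lt measurable_const (measurable_pi_apply 1))
  -- A copy of `u` and `v` in `ℂ`, with `u` on the positive real axis.
  let w : Fin 2 → ℂ := ![(‖u‖ : ℂ), ‖v‖ * Complex.exp (angle u v * Complex.I)]
  have hgram : ∀ i j, ⟪![u, v] i, ![u, v] j⟫ = ⟪w i, w j⟫ := by
    have huu : ⟪u, u⟫ = ⟪w 0, w 0⟫ := by simp [w]
    have hvv : ⟪v, v⟫ = ⟪w 1, w 1⟫ := by simp [w, Complex.norm_exp_ofReal_mul_I]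
    have hvu : ⟪v, u⟫ = ⟪w 1, w 0⟫ := by
      change _ = ⟪(‖v‖ : ℂ) * Complex.exp (angle u v * Complex.I), (‖u‖ : ℂ)⟫
      rw [inner_ofReal_mul_exp, Complex.arg_ofReal_of_nonneg (norm_nonneg u), zero_sub,
        Real.cos_neg, Complex.norm_real, norm_norm, real_inner_comm, ← cos_angle_mul_norm_mul_norm]
      ring
    have huv : ⟪u, v⟫ = ⟪w 0, w 1⟫ := by rwa [real_inner_comm, real_inner_comm (w 1)]
    exact Fin.forall_fin_two.2 ⟨Fin.forall_fin_two.2 ⟨huu, huv⟩, Fin.forall_fin_two.2 ⟨hvu, hvv⟩⟩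
  have hplane := measureReal_inner_pos_and_inner_pos_of_rotation_invariant (stdGaussian ℂ)
    (fun w => stdGaussian_map (rotation w)) stdGaussian_singleton_zero
    (norm_pos_iff.2 hu) (norm_pos_iff.2 hv) ⟨angle_nonneg u v, angle_le_pi u v⟩
  have hmap := congrArg (fun μ => μ.real {y | 0 < y 0 ∧ 0 < y 1})
    (stdGaussian_map_inner_eq_of_gram_eq hgram)
  rw [map_measureReal_apply (by fun_prop) hQ, map_measureReal_apply (by fun_prop) hQ] at hmap
  exact hmap.trans hplane

end Sheppard

section Rounding

variable {E : Type*} [NormedAddCommGroup E] [InnerProductSpace ℝ E]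

lemma exists_norm_eq_one_inner_eq {ι κ : Type*} {u : ι → E} {v : κ → E} (hu : ∀ a, ‖u a‖ ≤ 1)
    (hv : ∀ b, ‖v b‖ ≤ 1) :
    ∃ (u' : ι → WithLp 2 (E × ℂ)) (v' : κ → WithLp 2 (E × ℂ)),
      (∀ a, ‖u' a‖ = 1) ∧ (∀ b, ‖v' b‖ = 1) ∧ ∀ a b, ⟪u' a, v' b⟫ = ⟪u a, v b⟫ := by
  have hsq {x : E} (hx : ‖x‖ ≤ 1) : ‖x‖ ^ 2 + √(1 - ‖x‖ ^ 2) ^ 2 = 1 := by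
    rw [Real.sq_sqrt (sub_nonneg.2 (pow_le_one₀ (norm_nonneg x) hx)), add_sub_cancel]
  refine ⟨fun a => WithLp.toLp 2 (u a, (√(1 - ‖u a‖ ^ 2) : ℂ)),
    fun b => WithLp.toLp 2 (v b, √(1 - ‖v b‖ ^ 2) * Complex.I), fun a => ?_, fun b => ?_,
    fun a b => ?_⟩
  · rw [← pow_eq_one_iff_of_nonneg (norm_nonneg _) two_ne_zero, WithLp.prod_norm_sq_eq_of_L2]
    simpa using hsq (hu a)
  · rw [← pow_eq_one_iff_of_nonneg (norm_nonneg _) two_ne_zero, WithLp.prod_norm_sq_eq_of_L2]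
    simpa using hsq (hv b)
  · simp [WithLp.prod_inner_apply, Complex.inner]

variable [FiniteDimensional ℝ E] [MeasurableSpace E] [BorelSpace E]

lemma stdGaussian_real_inner_pos_and_inner_pos_of_norm_eq_one {u v : E} (hu : ‖u‖ = 1)
    (hv : ‖v‖ = 1) :
    (stdGaussian E).real {x | 0 < ⟪u, x⟫ ∧ 0 < ⟪v, x⟫} = sheppardH ⟪u, v⟫ := by
  rw [stdGaussian_real_inner_pos_and_inner_pos (norm_ne_zero_iff.1 (hu ▸ one_ne_zero))
    (norm_ne_zero_iff.1 (hv ▸ one_ne_zero)), InnerProductGeometry.angle, hu, hv, mul_one, div_one,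
    sheppardH]
  field_simp

end Rounding

section Sampling

lemma exists_pmf_rectangle_of_measurable {Ω A B : Type*} [MeasurableSpace Ω] [Finite A] [Finite B]
    (μ : Measure Ω) [IsProbabilityMeasure μ] {S : A → Set Ω} {T : B → Set Ω}
    (hS : ∀ a, MeasurableSet (S a)) (hT : ∀ b, MeasurableSet (T b)) :
    ∃ D : PMF (Rectangle A B), ∀ a b,
      D.toOuterMeasure {R | (a, b) ∈ R} = μ (S a ∩ T b) := by
  let f : Ω → Set A × Set B := fun x => ({a | x ∈ S a}, {b | x ∈ T b})
  have hf : Measurable f :=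
    (measurable_set_iff.2 fun a => measurable_mem.2 (hS a)).prodMk
      (measurable_set_iff.2 fun b => measurable_mem.2 (hT b))
  have := Measure.isProbabilityMeasure_map (μ := μ) hf.aemeasurable
  refine ⟨(μ.map f).toPMF.map fun s => ⟨s.1, s.2⟩, fun a b => ?_⟩
  rw [PMF.toOuterMeasure_map_apply,
    ← PMF.toMeasure_apply_eq_toOuterMeasure_apply _ (toFinite _).measurableSet,
    Measure.toPMF_toMeasure, Measure.map_apply hf (toFinite _).measurableSet]
  rfl

lemma exists_pmf_rectangle_pow_of_measurable {Ω A B : Type*} [MeasurableSpace Ω] [Finite A]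
    [Finite B] (μ : Measure Ω) [IsProbabilityMeasure μ] {S : A → Set Ω} {T : B → Set Ω}
    (hS : ∀ a, MeasurableSet (S a)) (hT : ∀ b, MeasurableSet (T b)) (k : ℕ) :
    ∃ D : PMF (Rectangle A B), ∀ a b,
      D.toOuterMeasure {R | (a, b) ∈ R} = μ (S a ∩ T b) ^ k := by
  obtain ⟨D, hD⟩ := exists_pmf_rectangle_of_measurable (Measure.pi fun _ : Fin k => μ)
    (fun a => MeasurableSet.univ_pi fun _ => hS a) (fun b => MeasurableSet.univ_pi fun _ => hT b)
  refine ⟨D, fun a b => ?_⟩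
  rw [hD, ← pi_inter_distrib, Measure.pi_pi, Finset.prod_const, Finset.card_univ,
    Fintype.card_fin]

theorem exists_pmf_rectangle_sheppardH_inner_pow {E A B : Type*} [NormedAddCommGroup E]
    [InnerProductSpace ℝ E] [FiniteDimensional ℝ E] [Finite A] [Finite B] {u : A → E} {v : B → E}
    (hu : ∀ a, ‖u a‖ ≤ 1) (hv : ∀ b, ‖v b‖ ≤ 1) (k : ℕ) :
    ∃ D : PMF (Rectangle A B), ∀ a b,
      (D.toOuterMeasure {R | (a, b) ∈ R}).toReal = sheppardH ⟪u a, v b⟫ ^ k := by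
  borelize E
  obtain ⟨u', v', hu', hv', huv⟩ := exists_norm_eq_one_inner_eq hu hv
  have hmeas (w : WithLp 2 (E × ℂ)) : MeasurableSet {x | 0 < ⟪w, x⟫} :=
    measurableSet_lt measurable_const (by fun_prop)
  obtain ⟨D, hD⟩ := exists_pmf_rectangle_pow_of_measurable (stdGaussian (WithLp 2 (E × ℂ)))
    (fun a => hmeas (u' a)) (fun b => hmeas (v' b)) k
  refine ⟨D, fun a b => ?_⟩
  rw [hD, ENNReal.toReal_pow, ← measureReal_def, ← huv,
    ← stdGaussian_real_inner_pos_and_inner_pos_of_norm_eq_one (hu' a) (hv' b)]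
  rfl

end Sampling

theorem mainTheorem6_general {A B : Type*} [Finite A] [Fintype B] {Δ : ℝ} (M : Matrix A B ℝ)
    (hM : ∀ a b, |M a b| ≤ Δ) (k : ℕ) :
    ∃ D : PMF (Rectangle A B), ∀ a b,
      (D.toOuterMeasure {R | (a, b) ∈ R}).toReal = sheppardH (M a b / (Δ * √M.rank)) ^ k := by
  cases nonempty_fintype A
  obtain ⟨u, v, huv, hu, hv⟩ := exists_inner_eq_of_abs_le M hM
  have hu' (a : A) : ‖(√M.rank)⁻¹ • u a‖ ≤ 1 := by
    rw [norm_smul, norm_inv, Real.norm_of_nonneg (Real.sqrt_nonneg _)]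
    exact inv_mul_le_one_of_le₀ (hu a) (Real.sqrt_nonneg _)
  have hv' (b : B) : ‖Δ⁻¹ • v b‖ ≤ 1 := by
    rw [norm_smul, norm_inv]
    exact inv_mul_le_one_of_le₀ (hv b) (norm_nonneg Δ)
  obtain ⟨D, hD⟩ := exists_pmf_rectangle_sheppardH_inner_pow hu' hv' k
  refine ⟨D, fun a b => ?_⟩
  rw [hD, real_inner_smul_left, real_inner_smul_right, huv, div_eq_mul_inv, mul_inv, mul_comm Δ⁻¹,
    mul_left_comm, mul_comm Δ⁻¹]

theorem mainTheorem6 {A B : Type*} [Fintype A] [Fintype B] (Δ r : ℕ) (M : Matrix A B ℕ)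
    (hM : ∀ a b, M a b ≤ Δ) (hr : (M.map (fun m : ℕ => (m : ℝ))).rank = r) (k : ℕ) :
    ∃ D : PMF (Rectangle A B), ∀ (a : A) (b : B),
      (D.toOuterMeasure {R : Rectangle A B | (a, b) ∈ R}).toReal =
        sheppardH ((M a b : ℝ) / ((Δ : ℝ) * Real.sqrt (r : ℝ))) ^ k := by
  rw [← hr]
  exact mainTheorem6_general (M.map Nat.cast) (fun a b => by simpa using hM a b) k
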